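/- **Setting.** There are $E$ environments, split into two disjoint sets $\mathcal E_1,\mathcal E_2$ of $E/2$ environments each. In each environment $e$ one observes $X^e\in\mathbb R^{n\times D}$ and $Y^e=X^e\beta^e+\varepsilon^e\in\mathbb R^n$, where $\beta^v=\beta^1$ for $v\in\mathcal E_1$, $\beta^w=\beta^2$ for $w\in\mathcal E_2$, and $\beta^e_d=0$ for all $d\notin S^*$, for a set $S^*\subseteq[D]$. In each environment the entries of $X^e$ are mutually independent, those of column $d$ being $N(\mu^e_d,(\sigma^e_d)^2)$ with $\sigma^e_d>0$; the only exception is that (at most) one fixed column may be the column of constant ones (an intercept, with $\mu^e_d=1$, $\sigma^e_d=0$). The noise variables $\varepsilon^e_i$ are $N(0,\sigma_Y^2)$ with $\sigma_Y>0$, mutually independent within an environment, independent between any two environments, and each $\varepsilon^e_i$ is independent of $(X^e_{d,i})_{d\in S^*}$. **The LoLICaP test.** For $S\subseteq[D]$ let $X^e_S$ consist of the columns of $X^e$ in $S$, let $r^e_S=Y^e-X^e_S((X^e_S)^TX^e_S)^\dagger (X^e_S)^TY^e$ be the least-squares residual, and let $T_S=\min_e\|r^e_S\|_2^2/\max_e\|r^e_S\|_2^2$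 ($T_S=\infty$ if all residuals vanish). Given the data, let $Z^e_S$, $e\in[E]$, be independent chi-squared variables with $n-\mathrm{rank}((X^e_S)^TX^e_S)$ degrees of freedom. At level $\alpha$ the test rejects $S$ ($\phi_S=1$) if $\mathbf P(T_S>\min_eZ^e_S/\max_eZ^e_S\mid X,Y)\le\alpha$, and accepts $S$ ($\phi_S=0$) otherwise. **Theorem 2.** Let $S\subseteq[D]$ with $S^*\not\subseteq S$ and $|S|<n$ (for example $n>D$), and put $U=S^*\setminus S$, $k=n-|S|$. Assume that in each environment the noise vector $\varepsilon^e$ is independent of the covariates with index in $S\cup S^*$, and that either the column of ones is one of the columns in $S$ or $\sum_{u\in U}\beta^e_u\mu^e_u=0$ for all $e$. For $v\in\mathcal E_1$, $w\in\mathcal E_2$ put $\rho_1=\sum_{u\in U}(\beta^1_u)^2(\sigma^v_u)^2+\sigma_Y^2$, $\rho_2=\sum_{u\in U}(\beta^2_u)^2(\sigma^w_u)^2+\sigma_Y^2$ and $I_S=\min\{\rho_1/\rho_2,\rho_2/\rho_1\}$. If $I_S<1$, then for every $\alpha>0$ $$\mathbf P(\phi_S=0)\le\frac{4E}{\alpha}\left(\Big(I_S^{-1/4}e^{1-I_S^{-1/4}}\Big)^{k/2}+\Big(I_S^{1/4}e^{1-I_S^{1/4}}\Big)^{k/2}\right).$$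 Since $ce^{1-c}<1$ for every real $c\ne1$, the probability of falsely accepting $S$ decays exponentially in $k$: with $$\gamma=-\tfrac12\log\max\Big\{I_S^{-1/4}e^{1-I_S^{-1/4}},\;I_S^{1/4}e^{1-I_S^{1/4}}\Big\}>0,$$ which depends on $I_S$ only, $\mathbf P(\phi_S=0)\le\frac{8E}{\alpha}e^{-\gamma k}$. -/

import Mathlib

open MeasureTheory ProbabilityTheory Matrix
open scoped ENNReal NNReal

namespace LoLICaP

/-- `B` is a Moore-Penrose inverse of the real matrix `A` (the four Penrose conditions). -/
structure IsMoorePenrose {m n : Type*} [Fintype m] [Fintype n]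
    (A : Matrix m n ℝ) (B : Matrix n m ℝ) : Prop where
  mul_mul_left : A * B * A = A
  mul_mul_right : B * A * B = B
  symm_left : (A * B)ᵀ = A * B
  symm_right : (B * A)ᵀ = B * A

theorem IsMoorePenrose.unique {m n : Type*} [Fintype m] [Fintype n]
    {A : Matrix m n ℝ} {B C : Matrix n m ℝ}
    (hB : IsMoorePenrose A B) (hC : IsMoorePenrose A C) : B = C := by
  have h1 : A * B = A * C := by
    calc A * B = (A * B)ᵀ := hB.symm_left.symm
      _ = ((A * C * A) * B)ᵀ := by rw [hC.mul_mul_left]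
      _ = (A * B)ᵀ * (A * C)ᵀ := by rw [← transpose_mul]; simp only [Matrix.mul_assoc]
      _ = A * B * A * C := by rw [hB.symm_left, hC.symm_left]; simp only [Matrix.mul_assoc]
      _ = A * C := by rw [hB.mul_mul_left]
  have h2 : B * A = C * A := by
    calc B * A = (B * A)ᵀ := hB.symm_right.symm
      _ = (B * (A * C * A))ᵀ := by rw [hC.mul_mul_left]
      _ = (C * A)ᵀ * (B * A)ᵀ := by rw [← transpose_mul]; simp only [Matrix.mul_assoc]
      _ = C * (A * B * A) := by rw [hB.symm_right, hC.symm_right]; simp only [Matrix.mul_assoc]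
      _ = C * A := by rw [hB.mul_mul_left]
  calc B = B * A * B := hB.mul_mul_right.symm
    _ = C * (A * B) := by rw [h2, Matrix.mul_assoc]
    _ = C * A * C := by rw [h1, Matrix.mul_assoc]
    _ = C := hC.mul_mul_right

theorem exists_isMoorePenrose_of_symm {m : Type*} [Fintype m] [DecidableEq m]
    {A : Matrix m m ℝ} (hA : A.IsHermitian) : ∃ B, Bᵀ = B ∧ IsMoorePenrose A B := by
  set U : Matrix m m ℝ := (hA.eigenvectorUnitary : Matrix m m ℝ) with hU
  set l : m → ℝ := hA.eigenvalues with hl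
  have hUU : Uᵀ * U = 1 := by
    have := (Matrix.mem_unitaryGroup_iff'.1 hA.eigenvectorUnitary.2)
    simpa [star_eq_conjTranspose, conjTranspose_eq_transpose_of_trivial] using this
  have hAd : A = U * diagonal l * Uᵀ := by
    have := hA.spectral_theorem
    rw [Unitary.conjStarAlgAut_apply] at this
    simpa [star_eq_conjTranspose, conjTranspose_eq_transpose_of_trivial, Function.comp_def]
      using this
  have key : ∀ a b : m → ℝ, (U * diagonal a * Uᵀ) * (U * diagonal b * Uᵀ)
      = U * diagonal (fun i => a i * b i) * Uᵀ := by
    intro a b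
    calc (U * diagonal a * Uᵀ) * (U * diagonal b * Uᵀ)
        = U * diagonal a * (Uᵀ * U) * diagonal b * Uᵀ := by simp only [Matrix.mul_assoc]
      _ = U * diagonal (fun i => a i * b i) * Uᵀ := by
        rw [hUU, Matrix.mul_one, Matrix.mul_assoc U, diagonal_mul_diagonal]
  have tr : ∀ a : m → ℝ, (U * diagonal a * Uᵀ)ᵀ = U * diagonal a * Uᵀ := by
    intro a
    simp [transpose_mul, Matrix.mul_assoc]
  refine ⟨U * diagonal (fun i => (l i)⁻¹) * Uᵀ, tr _, ?_, ?_, ?_, ?_⟩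
  · rw [hAd, key, key]
    congr 3
    funext i
    by_cases h : l i = 0 <;> simp [h]
  · rw [hAd, key, key]
    congr 3
    funext i
    by_cases h : l i = 0 <;> simp [h]
  · rw [hAd, key, tr]
  · rw [hAd, key, tr]

theorem exists_isMoorePenrose {m n : Type*} [Fintype m] [Fintype n]
    (A : Matrix m n ℝ) : ∃ B, IsMoorePenrose A B := by
  classical
  obtain ⟨H, hHs, hH⟩ := exists_isMoorePenrose_of_symm
    (A := Aᵀ * A) (by simpa [conjTranspose_eq_transpose_of_trivial] using
      isHermitian_conjTranspose_mul_self A)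
  refine ⟨H * Aᵀ, ?_, ?_, ?_, ?_⟩
  · have h0 : Aᴴ * A * (H * (Aᵀ * A) - 1) = 0 := by
      rw [conjTranspose_eq_transpose_of_trivial, Matrix.mul_sub, Matrix.mul_one,
        ← Matrix.mul_assoc, hH.mul_mul_left, sub_self]
    have h1 := (conjTranspose_mul_self_mul_eq_zero A _).1 h0
    rw [Matrix.mul_sub, Matrix.mul_one, sub_eq_zero] at h1
    simpa only [Matrix.mul_assoc] using h1
  · have := congrArg (· * Aᵀ) hH.mul_mul_right
    simpa only [Matrix.mul_assoc] using this
  · simp [transpose_mul, hHs, Matrix.mul_assoc]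
  · have := hH.symm_right
    simpa only [Matrix.mul_assoc] using this

/-- The Moore-Penrose inverse of a real matrix. -/
noncomputable def pinv {m n : Type*} [Fintype m] [Fintype n] (A : Matrix m n ℝ) :
    Matrix n m ℝ :=
  (exists_isMoorePenrose A).choose

theorem pinv_spec {m n : Type*} [Fintype m] [Fintype n] (A : Matrix m n ℝ) :
    IsMoorePenrose A (pinv A) :=
  (exists_isMoorePenrose A).choose_spec

/-- The submatrix `X_S` of `X` with columns in `S`. -/
def cols {n D : ℕ} (X : Matrix (Fin n) (Fin D) ℝ) (S : Finset (Fin D)) :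
    Matrix (Fin n) S ℝ :=
  X.submatrix id (fun d : S => (d : Fin D))

/-- The least-squares coefficients `(X_Sᵀ X_S)† X_Sᵀ y`. -/
noncomputable def betaHat {n D : ℕ} (S : Finset (Fin D))
    (X : Matrix (Fin n) (Fin D) ℝ) (y : Fin n → ℝ) : S → ℝ :=
  (pinv ((cols X S)ᵀ * cols X S) * (cols X S)ᵀ) *ᵥ y

/-- The residual vector `r_S = y - X_S (X_Sᵀ X_S)† X_Sᵀ y`. -/
noncomputable def residual {n D : ℕ} (S : Finset (Fin D))
    (X : Matrix (Fin n) (Fin D) ℝ) (y : Fin n → ℝ) : Fin n → ℝ :=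
  y - cols X S *ᵥ betaHat S X y

/-- The sum of squared residuals `‖r_S‖₂²`. -/
noncomputable def ssr {n D : ℕ} (S : Finset (Fin D))
    (X : Matrix (Fin n) (Fin D) ℝ) (y : Fin n → ℝ) : ℝ :=
  ∑ i, (residual S X y i) ^ 2

open Classical in
/-- The statistic `T_S`: the ratio of the smallest to the largest of the sums of squared residuals
over the environments, and `∞` if all of them vanish. -/
noncomputable def statT {E n D : ℕ} (S : Finset (Fin D))
    (X : Fin E → Matrix (Fin n) (Fin D) ℝ) (Y : Fin E → Fin n → ℝ) : ℝ≥0∞ :=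
  if ∃ e, 0 < ssr S (X e) (Y e) then
    ENNReal.ofReal ((⨅ e, ssr S (X e) (Y e)) / (⨆ e, ssr S (X e) (Y e)))
  else ∞

/-- The chi-squared distribution with `k` degrees of freedom: the law of the sum of the squares of
`k` independent standard normal variables (the point mass at `0` for `k = 0`). -/
noncomputable def chiSq (k : ℕ) : Measure ℝ :=
  (Measure.pi (fun _ : Fin k => gaussianReal 0 1)).map (fun g => ∑ i, (g i) ^ 2)

/-- The joint law of the reference variables `(Z^e_S)_e` given the covariates: independent
chi-squared variables, the one of environment `e` with `n - rank ((X^e_S)ᵀ X^e_S)` degrees of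
freedom. -/
noncomputable def refLaw {E n D : ℕ} (S : Finset (Fin D))
    (X : Fin E → Matrix (Fin n) (Fin D) ℝ) : Measure (Fin E → ℝ) :=
  Measure.pi (fun e => chiSq (n - ((cols (X e) S)ᵀ * cols (X e) S).rank))

/-- The conditional probability, given the data, that `T_S > min_e Z^e_S / max_e Z^e_S`. The
variables `Z^e_S` are drawn independently of everything else once the data are fixed, so this is
the probability under `refLaw` with the data held fixed. -/
noncomputable def pValue {E n D : ℕ} (S : Finset (Fin D))
    (X : Fin E → Matrix (Fin n) (Fin D) ℝ) (Y : Fin E → Fin n → ℝ) : ℝ≥0∞ :=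
  refLaw S X {z | ENNReal.ofReal ((⨅ e, z e) / (⨆ e, z e)) < statT S X Y}

open Classical in
/-- The test `φ_S` at level `α`: `1` rejects `S`, `0` accepts `S`. -/
noncomputable def phi {E n D : ℕ} (S : Finset (Fin D))
    (X : Fin E → Matrix (Fin n) (Fin D) ℝ) (Y : Fin E → Fin n → ℝ) (α : ℝ) : ℕ :=
  if pValue S X Y ≤ ENNReal.ofReal α then 1 else 0

/-- The locally linear model: `Y^e = X^e β^e + ε^e`, where `β^e` vanishes outside of `Sstar`, all
noise variables have the same centred law `F`, the noise variables of one environment are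
independent, and each of them is independent of the causal parents of the same observation. -/
structure PopulationModel {Ω : Type*} [MeasurableSpace Ω] (P : Measure Ω) {E n D : ℕ}
    (X : Fin E → Ω → Matrix (Fin n) (Fin D) ℝ) (Y ε : Fin E → Ω → Fin n → ℝ)
    (β : Fin E → Fin D → ℝ) (Sstar : Finset (Fin D)) (F : Measure ℝ) : Prop where
  measurable_X : ∀ e i d, Measurable (fun ω => X e ω i d)
  measurable_noise : ∀ e i, Measurable (fun ω => ε e ω i)
  coeff_eq_zero : ∀ e, ∀ d ∉ Sstar, β e d = 0
  model : ∀ e, ∀ᵐ ω ∂P, Y e ω = X e ω *ᵥ β e + ε e ω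
  integrable_noise : Integrable (fun x : ℝ => x) F
  mean_noise : ∫ x, x ∂F = 0
  noise_law : ∀ e i, HasLaw (fun ω => ε e ω i) F P
  noise_indep : ∀ e, iIndepFun (fun i ω => ε e ω i) P
  noise_indep_parents : ∀ e i,
    IndepFun (fun ω => ε e ω i) (fun ω (d : Sstar) => X e ω i d) P

/-- Gaussian noise: `F` is the centred normal law of variance `σY²`, and noise variables of
different environments are independent. -/
structure GaussianNoise {Ω : Type*} [MeasurableSpace Ω] (P : Measure Ω) {E n : ℕ}
    (ε : Fin E → Ω → Fin n → ℝ) (F : Measure ℝ) (σY : ℝ≥0) : Prop where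
  sd_pos : 0 < σY
  law_eq : F = gaussianReal 0 (σY ^ 2)
  indep_env : ∀ e v, e ≠ v → ∀ i j, IndepFun (fun ω => ε e ω i) (fun ω => ε v ω j) P

/-- Two types of environments with independent normal covariates. The environments are split into
two halves `E1`, `E2`; the coefficient vector is `β1` on `E1` and `β2` on `E2`; in environment `e`
the entries of `X^e` are mutually independent and those in column `d` are
`N(μ e d, (σ e d)²)`-distributed. At most one column, `one`, may be the column of constant ones
(mean `1`, standard deviation `0`); all other columns are nondegenerate. -/
structure TwoTypeEnvironments {Ω : Type*} [MeasurableSpace Ω] (P : Measure Ω) {E n D : ℕ}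
    (X : Fin E → Ω → Matrix (Fin n) (Fin D) ℝ) (β : Fin E → Fin D → ℝ)
    (E1 E2 : Finset (Fin E)) (β1 β2 : Fin D → ℝ) (μ : Fin E → Fin D → ℝ) (σ : Fin E → Fin D → ℝ≥0)
    (one : Option (Fin D)) : Prop where
  disjoint : Disjoint E1 E2
  union : E1 ∪ E2 = Finset.univ
  card_left : 2 * E1.card = E
  card_right : 2 * E2.card = E
  coeff_left : ∀ v ∈ E1, β v = β1
  coeff_right : ∀ w ∈ E2, β w = β2
  covariate_law : ∀ e i d, HasLaw (fun ω => X e ω i d) (gaussianReal (μ e d) (σ e d ^ 2)) P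
  covariate_indep : ∀ e, iIndepFun (fun (p : Fin n × Fin D) ω => X e ω p.1 p.2) P
  column_one : ∀ d, one = some d → ∀ e, μ e d = 1 ∧ σ e d = 0
  sd_pos : ∀ d, one ≠ some d → ∀ e, 0 < σ e d

/-- The residual variance `∑_{u ∈ U} b_u² s_u² + σY²`. -/
noncomputable def resVar {D : ℕ} (U : Finset (Fin D)) (b : Fin D → ℝ) (s : Fin D → ℝ≥0)
    (σY : ℝ≥0) : ℝ :=
  ∑ u ∈ U, (b u) ^ 2 * (s u : ℝ) ^ 2 + (σY : ℝ) ^ 2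

/-- The heterogeneity ratio `I_S` of an environment of the first type (coefficients `β1`, standard
deviations `sv`) and one of the second type (`β2`, `sw`), with `U = S* \ S`. -/
noncomputable def heteroRatio {D : ℕ} (Sstar S : Finset (Fin D)) (β1 β2 : Fin D → ℝ)
    (sv sw : Fin D → ℝ≥0) (σY : ℝ≥0) : ℝ :=
  min (resVar (Sstar \ S) β1 sv σY / resVar (Sstar \ S) β2 sw σY)
    (resVar (Sstar \ S) β2 sw σY / resVar (Sstar \ S) β1 sv σY)

/-- The function `c ↦ c e^{1-c}`. -/
noncomputable def bump (c : ℝ) : ℝ := c * Real.exp (1 - c)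

/-- The exponential rate in `k` read off from the two bases of the bound; it depends on the
heterogeneity ratio `I` alone. -/
noncomputable def decayRate (I : ℝ) : ℝ :=
  -(Real.log (max (bump (1 / I ^ (1 / 4 : ℝ))) (bump (I ^ (1 / 4 : ℝ))))) / 2

end LoLICaP

namespace LoLICaP

/-! Almost surely `X_S` has full column rank in every environment, so the residual is `M Y` with `M`
the orthogonal projection of rank `k` killing the columns in `S`. By `hcentre`, `M` also kills the
mean of the omitted columns, hence `M Y = M W` with `W = omitted ..`, a vector of independent `N(0,
ρ)` entries independent of `X_S`. Given `X_S`, the sum of squares is therefore `ρ` times a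
chi-squared variable with `k` degrees of freedom (`measure_ssr_mem_le`).

Let `q = I^(1/4)`, and let `a`, `c` be environments of the two types with `ρ_a = q⁴ ρ_c`. Chernoff
bounds give `ssr_a < ρ_a k / q` and `ssr_c > ρ_c q k` outside an event of probability at most `b₁ +
b₂`, the two terms of the bound; then `T_S ≤ q²`. All reference variables lie in `(qk, k/q)` outside
probability `E (b₁ + b₂)`, and then their ratio is at least `q²`. The fourth root is the choice that
makes these thresholds meet. So on good data the p-value is at most `E (b₁ + b₂)` (`pValue_le`). If
`α` is at least this, acceptance needs bad data; if not, the claimed bound exceeds 1. -/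

/-! ### Chernoff bounds for chi-squared variables -/

theorem bump_lt_one {c : ℝ} (hc : c ≠ 1) : bump c < 1 := by
  have h : c < Real.exp (c - 1) := by
    have := Real.add_one_lt_exp (sub_ne_zero.2 hc)
    linarith
  calc bump c < Real.exp (c - 1) * Real.exp (1 - c) :=
        mul_lt_mul_of_pos_right h (Real.exp_pos _)
    _ = 1 := by rw [← Real.exp_add]; simp

theorem bump_pos {c : ℝ} (hc : 0 < c) : 0 < bump c := mul_pos hc (Real.exp_pos _)

theorem gaussianPDFReal_mul_exp_sq (t x : ℝ) :
    gaussianPDFReal 0 1 x * Real.exp (t * x ^ 2)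
      = (√(2 * Real.pi))⁻¹ * Real.exp (-(1 / 2 - t) * x ^ 2) := by
  rw [gaussianPDFReal, mul_assoc, ← Real.exp_add]
  simp only [NNReal.coe_one, mul_one]
  congr 2
  ring

theorem integrable_exp_sq_gaussianReal {t : ℝ} (ht : t < 1 / 2) :
    Integrable (fun x => Real.exp (t * x ^ 2)) (gaussianReal 0 1) := by
  rw [gaussianReal_of_var_ne_zero _ one_ne_zero, integrable_withDensity_iff_integrable_smul'
    (measurable_gaussianPDF _ _) (ae_of_all _ fun _ => gaussianPDF_lt_top)]
  simp only [toReal_gaussianPDF, smul_eq_mul, gaussianPDFReal_mul_exp_sq]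
  exact (integrable_exp_neg_mul_sq (by linarith)).const_mul _

theorem integral_exp_sq_gaussianReal {t : ℝ} (ht : t < 1 / 2) :
    ∫ x, Real.exp (t * x ^ 2) ∂(gaussianReal 0 1) = (√(1 - 2 * t))⁻¹ := by
  rw [integral_gaussianReal_eq_integral_smul one_ne_zero]
  simp only [smul_eq_mul, gaussianPDFReal_mul_exp_sq]
  rw [integral_const_mul, integral_gaussian, ← Real.sqrt_inv, ← Real.sqrt_mul (by positivity),
    ← Real.sqrt_inv]
  congr 1
  have : (1 : ℝ) - 2 * t ≠ 0 := by linarith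
  have : (1 : ℝ) / 2 - t ≠ 0 := by linarith
  field_simp

section Tails

variable {ι : Type*} [Fintype ι]

/-- Zero exponents off `s` turn the partial sum into a product over all coordinates, to which Fubini
for the product measure applies. -/
theorem exp_mul_sum_sq_eq_prod (s : Finset ι) [DecidableEq ι] (t : ℝ) (x : ι → ℝ) :
    Real.exp (t * ∑ i ∈ s, x i ^ 2) = ∏ i, Real.exp ((if i ∈ s then t else 0) * x i ^ 2) := by
  rw [← Real.exp_sum, Finset.mul_sum]
  simp [ite_mul, Finset.sum_ite_mem]

theorem integrable_exp_sum_sq (s : Finset ι) {t : ℝ} (ht : t < 1 / 2) :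
    Integrable (fun x : ι → ℝ => Real.exp (t * ∑ i ∈ s, x i ^ 2))
      (Measure.pi fun _ => gaussianReal 0 1) := by
  classical
  simp_rw [exp_mul_sum_sq_eq_prod]
  refine Integrable.fintype_prod (f := fun i y => Real.exp ((if i ∈ s then t else 0) * y ^ 2))
    fun i => integrable_exp_sq_gaussianReal ?_
  split_ifs <;> linarith

theorem mgf_sum_sq (s : Finset ι) {t : ℝ} (ht : t < 1 / 2) :
    mgf (fun x : ι → ℝ => ∑ i ∈ s, x i ^ 2) (Measure.pi fun _ => gaussianReal 0 1) t
      = (√(1 - 2 * t))⁻¹ ^ s.card := by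
  classical
  rw [mgf]
  simp_rw [exp_mul_sum_sq_eq_prod]
  rw [integral_fintype_prod_eq_prod
    (f := fun i y => Real.exp ((if i ∈ s then t else 0) * y ^ 2))]
  have : ∀ i, ∫ y, Real.exp ((if i ∈ s then t else 0) * y ^ 2) ∂(gaussianReal 0 1)
      = if i ∈ s then (√(1 - 2 * t))⁻¹ else 1 := by
    intro i
    split_ifs
    · exact integral_exp_sq_gaussianReal ht
    · simp
  simp_rw [this]
  simp [Finset.prod_ite_mem]

/-- The value of the Chernoff bound for a chi-squared variable at the optimal parameter. -/
theorem exp_mul_inv_sqrt_pow {c : ℝ} (hc : 0 < c) (k : ℕ) :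
    Real.exp (-((1 - 1 / c) / 2) * (c * k)) * (√(1 - 2 * ((1 - 1 / c) / 2)))⁻¹ ^ k
      = bump c ^ ((k : ℝ) / 2) := by
  have h1 : 1 - 2 * ((1 - 1 / c) / 2) = c⁻¹ := by ring
  have h2 : -((1 - 1 / c) / 2) * (c * k) = (1 - c) * (k / 2) := by
    field_simp
    ring
  rw [h1, h2, Real.sqrt_inv, inv_inv, bump, Real.mul_rpow hc.le (Real.exp_pos _).le,
    Real.sqrt_eq_rpow, ← Real.rpow_natCast, ← Real.rpow_mul hc.le, ← Real.exp_mul, mul_comm]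
  congr 2
  ring

/-- Chernoff bound for the upper tail of a chi-squared variable. -/
theorem measureReal_sum_sq_ge_le (s : Finset ι) {c : ℝ} (hc : 1 < c) :
    (Measure.pi fun _ : ι => gaussianReal 0 1).real {x | c * s.card ≤ ∑ i ∈ s, x i ^ 2}
      ≤ bump c ^ ((s.card : ℝ) / 2) := by
  have h0 : 0 < 1 / c := by positivity
  have h1 : 1 / c ≤ 1 := by rw [div_le_one (by linarith)]; exact hc.le
  -- `t = (1 - 1/c)/2` minimises `exp (-t c k) (1 - 2t)^(-k/2)`; it is positive for `c > 1` and
  -- negative for `c < 1`, matching the two tails.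
  have ht : (1 - 1 / c) / 2 < 1 / 2 := by linarith
  have := measure_ge_le_exp_mul_mgf (c * s.card) (show 0 ≤ (1 - 1 / c) / 2 by linarith)
    (integrable_exp_sum_sq s ht)
  rwa [mgf_sum_sq s ht, exp_mul_inv_sqrt_pow (by linarith)] at this

/-- Chernoff bound for the lower tail of a chi-squared variable. -/
theorem measureReal_sum_sq_le_le (s : Finset ι) {c : ℝ} (h0 : 0 < c) (hc : c < 1) :
    (Measure.pi fun _ : ι => gaussianReal 0 1).real {x | ∑ i ∈ s, x i ^ 2 ≤ c * s.card}
      ≤ bump c ^ ((s.card : ℝ) / 2) := by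
  have h1 : 1 < 1 / c := by rwa [lt_div_iff₀ h0, one_mul]
  have ht : (1 - 1 / c) / 2 < 1 / 2 := by linarith
  have := measure_le_le_exp_mul_mgf (c * s.card) (show (1 - 1 / c) / 2 ≤ 0 by linarith)
    (integrable_exp_sum_sq s ht)
  rwa [mgf_sum_sq s ht, exp_mul_inv_sqrt_pow h0] at this

theorem chiSq_real_ge_le (k : ℕ) {c : ℝ} (hc : 1 < c) :
    (chiSq k).real {z | c * k ≤ z} ≤ bump c ^ ((k : ℝ) / 2) := by
  rw [chiSq, map_measureReal_apply (by fun_prop) (measurableSet_le (by fun_prop) (by fun_prop))]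
  simpa using measureReal_sum_sq_ge_le (Finset.univ : Finset (Fin k)) hc

theorem chiSq_real_le_le (k : ℕ) {c : ℝ} (h0 : 0 < c) (hc : c < 1) :
    (chiSq k).real {z | z ≤ c * k} ≤ bump c ^ ((k : ℝ) / 2) := by
  rw [chiSq, map_measureReal_apply (by fun_prop) (measurableSet_le (by fun_prop) (by fun_prop))]
  simpa using measureReal_sum_sq_le_le (Finset.univ : Finset (Fin k)) h0 hc

instance (k : ℕ) : IsProbabilityMeasure (chiSq k) :=
  Measure.isProbabilityMeasure_map (Measurable.aemeasurable (by fun_prop))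

end Tails

/-! ### Orthogonal projections of Gaussian vectors -/

section Projection

variable {ι : Type*} [Fintype ι]

theorem eigenvalues_eq_zero_or_one [DecidableEq ι] {M : Matrix ι ι ℝ} (hM : M.IsHermitian)
    (hid : M * M = M) (i : ι) : hM.eigenvalues i = 0 ∨ hM.eigenvalues i = 1 := by
  have h1 := hM.mulVec_eigenvectorBasis i
  have h2 : M *ᵥ (M *ᵥ ⇑(hM.eigenvectorBasis i)) = M *ᵥ ⇑(hM.eigenvectorBasis i) := by
    rw [mulVec_mulVec, hid]
  rw [h1, mulVec_smul, h1] at h2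
  have hne : (hM.eigenvectorBasis i : ι → ℝ) ≠ 0 := by
    intro h
    exact (hM.eigenvectorBasis.orthonormal.ne_zero i) (by ext j; exact congrFun h j)
  rw [← sub_eq_zero, smul_smul, ← sub_smul] at h2
  have h3 := (smul_eq_zero.1 h2).resolve_right hne
  have h4 : hM.eigenvalues i * (hM.eigenvalues i - 1) = 0 := by linarith
  rcases mul_eq_zero.1 h4 with h | h
  · exact Or.inl h
  · exact Or.inr (by linarith)

/-- The squared length of the projection of a standard normal vector is distributed as the sum of
squares of some of its coordinates, as many as the rank of the projection. -/
theorem exists_map_sum_sq_mulVec_eq {M : Matrix ι ι ℝ} (hM : M.IsHermitian) (hid : M * M = M) :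
    ∃ s : Finset ι, (s.card : ℝ) = M.trace ∧
      (Measure.pi fun _ : ι => gaussianReal 0 1).map (fun x => ∑ i, (M *ᵥ x) i ^ 2)
        = (Measure.pi fun _ : ι => gaussianReal 0 1).map (fun x => ∑ i ∈ s, x i ^ 2) := by
  classical
  have hl := eigenvalues_eq_zero_or_one hM hid
  refine ⟨Finset.univ.filter fun i => hM.eigenvalues i = 1, ?_, ?_⟩
  · rw [hM.trace_eq_sum_eigenvalues, Finset.card_filter]
    push_cast
    refine Finset.sum_congr rfl fun i _ => ?_
    rcases hl i with h | h <;> simp [h]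
  · set b := hM.eigenvectorBasis
    have hF : Measurable fun y : EuclideanSpace ℝ ι => ∑ i, (M *ᵥ y.ofLp) i ^ 2 := by
      simp only [mulVec, dotProduct]
      fun_prop
    -- Rotation invariance: the standard Gaussian has independent `N(0,1)` coordinates in the
    -- eigenbasis of `M` too, where `M` just selects the coordinates of eigenvalue 1.
    have h := (map_pi_eq_stdGaussian (ι := ι)).trans (stdGaussian_eq_map_pi_orthonormalBasis b)
    have h' := congrArg (Measure.map fun y : EuclideanSpace ℝ ι => ∑ i, (M *ᵥ y.ofLp) i ^ 2) h
    rw [Measure.map_map hF (by fun_prop), Measure.map_map hF (by fun_prop)] at h'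
    refine h'.trans (congrArg (fun f => Measure.map f _) ?_)
    funext x
    have h1 : WithLp.toLp 2 (M *ᵥ (∑ i, x i • b i : EuclideanSpace ℝ ι).ofLp)
        = ∑ i, (x i * hM.eigenvalues i) • b i := by
      ext j
      simp only [WithLp.ofLp_sum, WithLp.ofLp_smul, mulVec_sum, mulVec_smul]
      simp [b, hM.mulVec_eigenvectorBasis, mul_assoc]
    have h2 := congrArg (fun y => ‖y‖ ^ 2) h1
    simp only [EuclideanSpace.real_norm_sq_eq] at h2
    simp only [Function.comp_apply]
    rw [h2, ← EuclideanSpace.real_norm_sq_eq, ← real_inner_self_eq_norm_sq,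
      b.orthonormal.inner_sum, Finset.sum_filter]
    refine Finset.sum_congr rfl fun i _ => ?_
    rcases hl i with h | h <;> simp [h, sq]

end Projection

/-! ### The residual projection and its measurability -/

section Hat

variable {n : ℕ} {κ : Type*} [Fintype κ] [DecidableEq κ]

/-- The matrix `1 - A (AᵀA)⁻¹ Aᵀ`, which maps a vector to its least-squares residual when
the columns of `A` are linearly independent. -/
noncomputable def residualMaker (A : Matrix (Fin n) κ ℝ) : Matrix (Fin n) (Fin n) ℝ :=
  1 - A * (Aᵀ * A)⁻¹ * Aᵀ

theorem residualMaker_isHermitian (A : Matrix (Fin n) κ ℝ) : (residualMaker A).IsHermitian := by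
  rw [IsHermitian, conjTranspose_eq_transpose_of_trivial, residualMaker]
  simp [transpose_nonsing_inv, Matrix.mul_assoc]

theorem residualMaker_mul {A : Matrix (Fin n) κ ℝ} (hA : (Aᵀ * A).det ≠ 0) :
    residualMaker A * A = 0 := by
  rw [residualMaker, Matrix.sub_mul, Matrix.mul_assoc _ Aᵀ, Matrix.mul_assoc A,
    nonsing_inv_mul _ hA.isUnit]
  simp

theorem residualMaker_mul_self {A : Matrix (Fin n) κ ℝ} (hA : (Aᵀ * A).det ≠ 0) :
    residualMaker A * residualMaker A = residualMaker A := by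
  conv_lhs => rhs; rw [residualMaker]
  rw [Matrix.mul_sub, ← Matrix.mul_assoc, ← Matrix.mul_assoc, residualMaker_mul hA]
  simp

theorem trace_residualMaker {A : Matrix (Fin n) κ ℝ} (hA : (Aᵀ * A).det ≠ 0) :
    (residualMaker A).trace = n - Fintype.card κ := by
  rw [residualMaker, trace_sub, Matrix.mul_assoc, trace_mul_comm A, Matrix.mul_assoc,
    nonsing_inv_mul _ hA.isUnit]
  simp

theorem pinv_eq_inv {G : Matrix κ κ ℝ} (hG : G.det ≠ 0) : pinv G = G⁻¹ := by
  have h1 := nonsing_inv_mul _ hG.isUnit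
  have h2 := mul_nonsing_inv _ hG.isUnit
  exact (pinv_spec G).unique ⟨by simp [h2], by simp [h1], by simp [h2], by simp [h1]⟩

theorem measurable_det_gram :
    Measurable fun A : Fin n → κ → ℝ => ((Matrix.of A)ᵀ * Matrix.of A).det := by
  have : Continuous fun A : Fin n → κ → ℝ => ((Matrix.of A)ᵀ * Matrix.of A).det :=
    Continuous.matrix_det (Continuous.matrix_mul continuous_id.matrix_transpose continuous_id)
  exact this.measurable

/-- Writing the inverse as `det⁻¹` times the adjugate gives measurability everywhere, singular Gram
matrices included. -/
theorem measurable_gram_inv_apply (i j : κ) :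
    Measurable fun A : Fin n → κ → ℝ => ((Matrix.of A)ᵀ * Matrix.of A)⁻¹ i j := by
  have h : Continuous fun A : Fin n → κ → ℝ => ((Matrix.of A)ᵀ * Matrix.of A).adjugate i j :=
    ((Continuous.matrix_mul continuous_id.matrix_transpose
      continuous_id).matrix_adjugate).matrix_elem i j
  simp only [inv_def, Ring.inverse_eq_inv', Matrix.smul_apply, smul_eq_mul]
  exact measurable_det_gram.inv.mul h.measurable

theorem measurable_residualMaker_apply (i j : Fin n) :
    Measurable fun A : Fin n → κ → ℝ => residualMaker (Matrix.of A) i j := by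
  have := measurable_gram_inv_apply (n := n) (κ := κ)
  simp only [residualMaker, Matrix.sub_apply, Matrix.mul_apply, transpose_apply, of_apply]
  refine measurable_const.sub (Finset.measurable_sum _ fun a _ => Measurable.mul
    (Finset.measurable_sum _ fun b _ => Measurable.mul (by fun_prop) (this b a)) (by fun_prop))

theorem measurable_residualMaker_mulVec :
    Measurable fun p : (Fin n → κ → ℝ) × (Fin n → ℝ) => residualMaker (Matrix.of p.1) *ᵥ p.2 := by
  simp only [measurable_pi_iff, mulVec, dotProduct]
  intro i
  exact Finset.measurable_sum _ fun j _ =>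
    ((measurable_residualMaker_apply i j).comp measurable_fst).mul
      ((measurable_pi_apply j).comp measurable_snd)

/-- `AᵀA` and `A` have the same kernel. -/
theorem det_gram_ne_zero_iff (A : Matrix (Fin n) κ ℝ) :
    (Aᵀ * A).det ≠ 0 ↔ LinearIndependent ℝ A.col := by
  rw [← mulVec_injective_iff, ← isUnit_iff_ne_zero, ← isUnit_iff_isUnit_det,
    ← mulVec_injective_iff_isUnit, ← coe_mulVecLin, ← coe_mulVecLin,
    ← LinearMap.ker_eq_bot, ← LinearMap.ker_eq_bot, ← conjTranspose_eq_transpose_of_trivial A,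
    ker_mulVecLin_conjTranspose_mul_self]

end Hat

theorem residual_eq_residualMaker_mulVec {n D : ℕ} {S : Finset (Fin D)}
    {X : Matrix (Fin n) (Fin D) ℝ} (hX : ((cols X S)ᵀ * cols X S).det ≠ 0) (y : Fin n → ℝ) :
    residual S X y = residualMaker (cols X S) *ᵥ y := by
  rw [residual, betaHat, pinv_eq_inv hX, residualMaker, mulVec_mulVec, sub_mulVec, one_mulVec,
    Matrix.mul_assoc]

/-! ### Gaussian linear combinations and independence -/

section Gaussian

variable {Ω : Type*} [MeasurableSpace Ω] {P : Measure Ω}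

theorem hasLaw_sum_gaussianReal {κ : Type*} {Z : κ → Ω → ℝ} {m : κ → ℝ}
    {v : κ → ℝ≥0} (hZ : ∀ j, HasLaw (Z j) (gaussianReal (m j) (v j)) P)
    (hm : ∀ j, Measurable (Z j)) (hind : iIndepFun Z P) (s : Finset κ) :
    HasLaw (fun ω => ∑ j ∈ s, Z j ω) (gaussianReal (∑ j ∈ s, m j) (∑ j ∈ s, v j)) P := by
  classical
  have := hind.isProbabilityMeasure
  induction s using Finset.induction_on with
  | empty =>
    simp only [Finset.sum_empty, gaussianReal_zero_var]
    exact hasLaw_dirac_of_ae_eq (ae_of_all _ fun _ => rfl)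
  | insert a s ha ih =>
    simp only [Finset.sum_insert ha]
    have h := (hind.indepFun_finsetSum_of_notMem hm ha).symm
    have hfun : (∑ j ∈ s, Z j) = fun ω => ∑ j ∈ s, Z j ω := by
      ext ω; simp
    rw [hfun] at h
    refine ⟨by fun_prop, ?_⟩
    exact gaussianReal_add_gaussianReal_of_indepFun h (hZ a).map_eq ih.map_eq

theorem hasLaw_sum_mul_sub_gaussianReal {κ : Type*} {Z : κ → Ω → ℝ} {m : κ → ℝ}
    {v : κ → ℝ≥0} (hZ : ∀ j, HasLaw (Z j) (gaussianReal (m j) (v j)) P)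
    (hm : ∀ j, Measurable (Z j)) (hind : iIndepFun Z P) (s : Finset κ) (c : κ → ℝ) :
    HasLaw (fun ω => ∑ j ∈ s, c j * (Z j ω - m j))
      (gaussianReal 0 (∑ j ∈ s, (c j ^ 2).toNNReal * v j)) P := by
  have h := hasLaw_sum_gaussianReal (P := P) (Z := fun j ω => c j * (Z j ω - m j)) (m := fun _ => 0)
    (v := fun j => (c j ^ 2).toNNReal * v j) ?_ (fun j => by have := hm j; fun_prop) ?_ s
  · simpa using h
  · intro j
    have := gaussianReal_const_mul (gaussianReal_sub_const (hZ j) (m j)) (c j)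
    rw [sub_self, mul_zero] at this
    convert this
    exact Real.toNNReal_of_nonneg (sq_nonneg _)
  · exact hind.comp (fun j x => c j * (x - m j)) fun j => by fun_prop

theorem hasLaw_pi_eval {ι : Type*} [Fintype ι] (ν : ι → Measure ℝ) [∀ i, IsProbabilityMeasure (ν i)]
    (i : ι) : HasLaw (fun x : ι → ℝ => x i) (ν i) (Measure.pi ν) :=
  (measurePreserving_eval ν i).hasLaw

theorem iIndepFun_pi_eval {ι : Type*} [Fintype ι] (ν : ι → Measure ℝ)
    [∀ i, IsProbabilityMeasure (ν i)] :
    iIndepFun (fun i (x : ι → ℝ) => x i) (Measure.pi ν) :=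
  iIndepFun_pi (X := fun _ x => x) fun _ => aemeasurable_id

theorem hasLaw_pi_sum_mul_gaussianReal {ι : Type*} [Fintype ι] (r : ℝ≥0) (c : ι → ℝ) :
    HasLaw (fun x : ι → ℝ => ∑ i, c i * x i) (gaussianReal 0 ((∑ i, c i ^ 2).toNNReal * r))
      (Measure.pi fun _ => gaussianReal 0 r) := by
  have h := hasLaw_sum_mul_sub_gaussianReal (hasLaw_pi_eval fun _ : ι => gaussianReal 0 r)
    (fun _ => by fun_prop) (iIndepFun_pi_eval _) Finset.univ c
  simp only [sub_zero] at h
  rwa [← Finset.sum_mul, ← Real.toNNReal_sum_of_nonneg fun i _ => sq_nonneg _] at h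

/-- A random vector is a vector of independent centred normal variables of variance `r` if all its
linear combinations are normal with the corresponding variance. -/
theorem hasLaw_pi_gaussianReal_of_forall {ι : Type*} [Fintype ι] [IsProbabilityMeasure P] {r : ℝ≥0}
    {W : Ω → ι → ℝ} (hW : Measurable W)
    (h : ∀ c : ι → ℝ, HasLaw (fun ω => ∑ i, c i * W ω i)
      (gaussianReal 0 ((∑ i, c i ^ 2).toNNReal * r)) P) :
    HasLaw W (Measure.pi fun _ => gaussianReal 0 r) P := by
  classical
  refine ⟨hW.aemeasurable, ?_⟩
  have := Measure.isProbabilityMeasure_map (μ := P) hW.aemeasurable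
  -- Cramér–Wold: the characteristic function at a functional `L` is that of the law of `L` at 1, so
  -- the laws of linear forms determine the joint law.
  refine Measure.ext_of_charFunDual (funext fun L => ?_)
  have hL : ∀ x : ι → ℝ, L x = ∑ i, L (Pi.single i 1) * x i := by
    intro x
    conv_lhs => rw [pi_eq_sum_univ' x]
    simp [map_sum, mul_comm]
  have hL' : (L : (ι → ℝ) → ℝ) = fun x => ∑ i, L (Pi.single i 1) * x i := funext hL
  rw [charFunDual_eq_charFun_map_one, charFunDual_eq_charFun_map_one,
    Measure.map_map (by fun_prop) hW, hL', (hasLaw_pi_sum_mul_gaussianReal r _).map_eq,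
    ← (h fun i => L (Pi.single i 1)).map_eq]
  rfl

/-- The hypotheses make the law of `((A, B), C)` a triple product; reassociating it gives the claim.
-/
theorem indepFun_prodMk_of_indepFun {α β γ : Type*} [MeasurableSpace α] [MeasurableSpace β]
    [MeasurableSpace γ] [IsProbabilityMeasure P] {A : Ω → α} {B : Ω → β} {C : Ω → γ}
    (hA : Measurable A) (hB : Measurable B) (hC : Measurable C) (hAB : IndepFun A B P)
    (hC' : IndepFun C (fun ω => (A ω, B ω)) P) : IndepFun A (fun ω => (B ω, C ω)) P := by
  have hBC : IndepFun B C P := (hC'.comp measurable_id measurable_snd).symm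
  have h1 := (indepFun_iff_map_prod_eq_prod_map_map (hA.prodMk hB).aemeasurable
    hC.aemeasurable).1 hC'.symm
  rw [(indepFun_iff_map_prod_eq_prod_map_map hA.aemeasurable hB.aemeasurable).1 hAB] at h1
  rw [indepFun_iff_map_prod_eq_prod_map_map hA.aemeasurable (hB.prodMk hC).aemeasurable,
    (indepFun_iff_map_prod_eq_prod_map_map hB.aemeasurable hC.aemeasurable).1 hBC]
  have := Measure.isProbabilityMeasure_map (μ := P) hA.aemeasurable
  have := Measure.isProbabilityMeasure_map (μ := P) hB.aemeasurable
  have := Measure.isProbabilityMeasure_map (μ := P) hC.aemeasurable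
  rw [← (measurePreserving_prodAssoc (P.map A) (P.map B) (P.map C)).map_eq, ← h1,
    Measure.map_map (by fun_prop) (by fun_prop)]
  rfl

end Gaussian

/-! ### The omitted part of the response -/

section Environment

variable {Ω : Type*} [MeasurableSpace Ω] {P : Measure Ω} {n D : ℕ}

theorem indepFun_cols {X : Ω → Matrix (Fin n) (Fin D) ℝ}
    (hX : ∀ i d, Measurable fun ω => X ω i d)
    (hind : iIndepFun (fun (p : Fin n × Fin D) ω => X ω p.1 p.2) P) {S T : Finset (Fin D)}
    (hST : Disjoint S T) :
    IndepFun (fun ω (i : Fin n) (d : S) => X ω i d) (fun ω (i : Fin n) (d : T) => X ω i d) P := by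
  have h := hind.indepFun_finset (Finset.univ ×ˢ S) (Finset.univ ×ˢ T)
    (Finset.disjoint_product.2 (Or.inr hST)) fun p => hX p.1 p.2
  exact h.comp
    (φ := fun (x : ↥(Finset.univ ×ˢ S : Finset (Fin n × Fin D)) → ℝ) (i : Fin n) (d : S) =>
      x ⟨(i, d), by simp⟩)
    (ψ := fun (x : ↥(Finset.univ ×ˢ T : Finset (Fin n × Fin D)) → ℝ) (i : Fin n) (d : T) =>
      x ⟨(i, d), by simp⟩)
    (by fun_prop) (by fun_prop)

/-- The centred contribution of the columns in `U` to the response, plus noise. -/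
def omitted (U : Finset (Fin D)) (b μ : Fin D → ℝ) (x : Matrix (Fin n) (Fin D) ℝ)
    (ε : Fin n → ℝ) (i : Fin n) : ℝ :=
  ∑ u ∈ U, b u * (x i u - μ u) + ε i

variable {X : Ω → Matrix (Fin n) (Fin D) ℝ} {ε : Ω → Fin n → ℝ}
  {Sstar S : Finset (Fin D)} {b μ : Fin D → ℝ} {σ : Fin D → ℝ≥0} {σY : ℝ≥0}

theorem measurable_omitted (U : Finset (Fin D)) (hX : ∀ i d, Measurable fun ω => X ω i d)
    (hε : ∀ i, Measurable fun ω => ε ω i) :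
    Measurable fun ω => omitted U b μ (X ω) (ε ω) := by
  simp only [measurable_pi_iff, omitted]
  fun_prop

theorem indepFun_noise_omitted_cols (hnoise : IndepFun (fun ω => ε ω)
      (fun ω (i : Fin n) (d : ↥(S ∪ Sstar)) => X ω i d) P) (c : Fin n → ℝ) :
    IndepFun (fun ω => ∑ p ∈ Finset.univ ×ˢ (Sstar \ S), c p.1 * b p.2 * (X ω p.1 p.2 - μ p.2))
      (fun ω => ∑ i, c i * ε ω i) P := by
  have h := hnoise.symm.comp
    (φ := fun x : Fin n → ↥(S ∪ Sstar) → ℝ => ∑ p : ↥(Finset.univ ×ˢ (Sstar \ S) :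
      Finset (Fin n × Fin D)), c p.1.1 * b p.1.2 * (x p.1.1 ⟨p.1.2, Finset.mem_union_right _
        (Finset.mem_sdiff.1 (Finset.mem_product.1 p.2).2).1⟩ - μ p.1.2))
    (ψ := fun y : Fin n → ℝ => ∑ i, c i * y i) (by fun_prop) (by fun_prop)
  refine h.congr (ae_of_all _ fun ω => ?_) (Filter.EventuallyEq.refl _ _)
  simp only [Function.comp_apply]
  rw [← Finset.sum_coe_sort (Finset.univ ×ˢ (Sstar \ S))]

theorem resVar_nonneg (U : Finset (Fin D)) (b : Fin D → ℝ) (s : Fin D → ℝ≥0) (σY : ℝ≥0) :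
    0 ≤ resVar U b s σY := by
  rw [resVar]; positivity

variable [IsProbabilityMeasure P]

/-- This permits freezing `X_S`, hence the projection, without changing the law of the vector
projected. Columns in `S` and in `S* \ S` are independent, and the noise is independent of both
blocks jointly. -/
theorem indepFun_omitted (hX : ∀ i d, Measurable fun ω => X ω i d)
    (hε : ∀ i, Measurable fun ω => ε ω i)
    (hind : iIndepFun (fun (p : Fin n × Fin D) ω => X ω p.1 p.2) P)
    (hnoise : IndepFun (fun ω => ε ω)
      (fun ω (i : Fin n) (d : ↥(S ∪ Sstar)) => X ω i d) P) :
    IndepFun (fun ω (i : Fin n) (d : S) => X ω i d)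
      (fun ω => omitted (Sstar \ S) b μ (X ω) (ε ω)) P := by
  have h1 := indepFun_cols hX hind (S := S) (T := Sstar \ S) Finset.disjoint_sdiff
  have h2 : IndepFun (fun ω => ε ω)
      (fun ω => ((fun (i : Fin n) (d : S) => X ω i d),
        (fun (i : Fin n) (d : ↥(Sstar \ S)) => X ω i d))) P :=
    hnoise.comp (φ := id)
      (ψ := fun x : Fin n → ↥(S ∪ Sstar) → ℝ =>
        ((fun i (d : S) => x i ⟨d, Finset.mem_union_left _ d.2⟩),
        (fun i (d : ↥(Sstar \ S)) =>
          x i ⟨d, Finset.mem_union_right _ (Finset.mem_sdiff.1 d.2).1⟩)))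
      measurable_id (by fun_prop)
  have h3 := indepFun_prodMk_of_indepFun (by fun_prop) (by fun_prop) (by fun_prop) h1 h2
  have h4 := h3.comp (φ := id)
    (ψ := fun p : (Fin n → ↥(Sstar \ S) → ℝ) × (Fin n → ℝ) => fun i : Fin n =>
      ∑ u : ↥(Sstar \ S), b u * (p.1 i u - μ u) + p.2 i)
    measurable_id (by fun_prop)
  refine h4.congr (Filter.EventuallyEq.refl _ _) (ae_of_all _ fun ω => funext fun i => ?_)
  simp only [omitted, Function.comp_apply]
  rw [← Finset.sum_coe_sort (Sstar \ S)]

theorem hasLaw_omitted (hX : ∀ i d, Measurable fun ω => X ω i d)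
    (hε : ∀ i, Measurable fun ω => ε ω i)
    (hXlaw : ∀ i d, HasLaw (fun ω => X ω i d) (gaussianReal (μ d) (σ d ^ 2)) P)
    (hind : iIndepFun (fun (p : Fin n × Fin D) ω => X ω p.1 p.2) P)
    (hεlaw : ∀ i, HasLaw (fun ω => ε ω i) (gaussianReal 0 (σY ^ 2)) P)
    (hεind : iIndepFun (fun i ω => ε ω i) P)
    (hnoise : IndepFun (fun ω => ε ω)
      (fun ω (i : Fin n) (d : ↥(S ∪ Sstar)) => X ω i d) P) :
    HasLaw (fun ω => omitted (Sstar \ S) b μ (X ω) (ε ω))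
      (Measure.pi fun _ => gaussianReal 0 (resVar (Sstar \ S) b σ σY).toNNReal) P := by
  -- A linear form with coefficients `c` splits into independent covariate and noise parts, with
  -- total variance `(∑ c_i²) · resVar`.
  refine hasLaw_pi_gaussianReal_of_forall (measurable_omitted _ hX hε) fun c => ?_
  have h1 := hasLaw_sum_mul_sub_gaussianReal (Z := fun (p : Fin n × Fin D) ω => X ω p.1 p.2)
    (m := fun p => μ p.2) (v := fun p => σ p.2 ^ 2) (fun p => hXlaw p.1 p.2)
    (fun p => hX p.1 p.2) hind (Finset.univ ×ˢ (Sstar \ S)) (fun p => c p.1 * b p.2)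
  have h2 := hasLaw_sum_mul_sub_gaussianReal (m := fun _ => 0) hεlaw hε hεind Finset.univ c
  simp only [sub_zero] at h2
  have h3 := gaussianReal_add_gaussianReal_of_indepFun
    (indepFun_noise_omitted_cols hnoise c) h1.map_eq h2.map_eq
  have hfun : (fun ω => ∑ i, c i * omitted (Sstar \ S) b μ (X ω) (ε ω) i)
      = (fun ω => ∑ p ∈ Finset.univ ×ˢ (Sstar \ S), c p.1 * b p.2 * (X ω p.1 p.2 - μ p.2))
        + fun ω => ∑ i, c i * ε ω i := by
    ext ω
    simp only [omitted, Pi.add_apply, mul_add, Finset.sum_add_distrib, Finset.mul_sum,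
      Finset.sum_product, mul_assoc]
  refine ⟨by rw [hfun]; exact (h1.aemeasurable.add h2.aemeasurable), ?_⟩
  rw [hfun, h3, add_zero]
  congr 1
  apply NNReal.eq
  have hs : (0 : ℝ) ≤ ∑ i, c i ^ 2 := Finset.sum_nonneg fun i _ => sq_nonneg _
  push_cast [Real.coe_toNNReal _ (sq_nonneg _), Real.coe_toNNReal _ hs,
    Real.coe_toNNReal _ (resVar_nonneg _ _ _ _)]
  rw [resVar, mul_add, Finset.sum_product, Finset.sum_mul_sum, Finset.sum_mul]
  simp only [mul_pow, mul_assoc]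

end Environment

/-! ### Almost sure full column rank -/

/-- A nonzero row of `M` gives a nondegenerate normal linear form, whose law has no atoms. -/
theorem measure_pi_gaussianReal_mulVec_eq_zero {ι : Type*} [Fintype ι] {M : Matrix ι ι ℝ}
    (hM : M ≠ 0) (m : ℝ) {v : ℝ≥0} (hv : 0 < v) :
    (Measure.pi fun _ : ι => gaussianReal m v) {x | M *ᵥ x = 0} = 0 := by
  obtain ⟨i, hi⟩ : ∃ i, M i ≠ 0 := by
    by_contra! h
    exact hM (funext h)
  obtain ⟨j, hj⟩ : ∃ j, M i j ≠ 0 := by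
    by_contra! h
    exact hi (funext h)
  have h := hasLaw_sum_mul_sub_gaussianReal (hasLaw_pi_eval fun _ : ι => gaussianReal m v)
    (fun _ => by fun_prop) (iIndepFun_pi_eval _) Finset.univ (M i)
  have hpos : (∑ j, (M i j ^ 2).toNNReal * v) ≠ 0 := by
    refine (Finset.sum_pos' (fun _ _ => bot_le) ⟨j, Finset.mem_univ j, ?_⟩).ne'
    exact mul_pos (Real.toNNReal_pos.2 (by positivity)) hv
  have := nullSingletonClass_gaussianReal (μ := 0) hpos
  refine measure_mono_null (t := (fun x : ι → ℝ => ∑ j, M i j * (x j - m)) ⁻¹'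
    {-∑ j, M i j * m}) (fun x hx => ?_) ?_
  · have := congrFun (show M *ᵥ x = 0 from hx) i
    simp only [mulVec, dotProduct, Pi.zero_apply] at this
    simp [mul_sub, this]
  · rw [← Measure.map_apply (by fun_prop) (measurableSet_singleton _), h.map_eq]
    exact measure_singleton _

section FullRank

variable {Ω : Type*} [MeasurableSpace Ω] {P : Measure Ω} [IsProbabilityMeasure P] {n D : ℕ}
  {X : Ω → Matrix (Fin n) (Fin D) ℝ} {μ : Fin D → ℝ} {σ : Fin D → ℝ≥0} {S : Finset (Fin D)}

/-- A column in the span of the columns in `S` is killed by their residual projection. With `X_S`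
frozen this projection is nonzero, so an independent Gaussian column is killed with probability 0;
Fubini concludes. -/
theorem ae_linearIndepOn_insert (hX : ∀ i d, Measurable fun ω => X ω i d)
    (hXlaw : ∀ i d, HasLaw (fun ω => X ω i d) (gaussianReal (μ d) (σ d ^ 2)) P)
    (hind : iIndepFun (fun (p : Fin n × Fin D) ω => X ω p.1 p.2) P)
    {d : Fin D} (hd : d ∉ S) (hσ : 0 < σ d) (hS : S.card < n)
    (h : ∀ᵐ ω ∂P, LinearIndepOn ℝ (fun d i => X ω i d) (S : Set (Fin D))) :
    ∀ᵐ ω ∂P, LinearIndepOn ℝ (fun d i => X ω i d) (insert d S : Set (Fin D)) := by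
  have hpair : IndepFun (fun ω (i : Fin n) (d : S) => X ω i d) (fun ω (i : Fin n) => X ω i d) P :=
    (indepFun_cols hX hind (S := S) (T := {d}) (by simpa using hd)).comp
      (φ := id) (ψ := fun (x : Fin n → ↥({d} : Finset (Fin D)) → ℝ) (i : Fin n) => x i ⟨d, by simp⟩)
      measurable_id (by fun_prop)
  have hlaw : HasLaw (fun ω (i : Fin n) => X ω i d)
      (Measure.pi fun _ => gaussianReal (μ d) (σ d ^ 2)) P :=
    iIndepFun.hasLaw_pi (fun i => hXlaw i d)
      (hind.precomp (g := fun i => (i, d)) fun i j hij => by simpa using hij)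
  have hmS : Measurable fun ω (i : Fin n) (d : S) => X ω i d := by fun_prop
  have hmd : Measurable fun ω (i : Fin n) => X ω i d := by fun_prop
  set N : Set ((Fin n → S → ℝ) × (Fin n → ℝ)) :=
    {p | ((Matrix.of p.1)ᵀ * Matrix.of p.1).det ≠ 0 ∧ residualMaker (Matrix.of p.1) *ᵥ p.2 = 0}
    with hN
  have hNm : MeasurableSet N :=
    ((measurable_det_gram.comp measurable_fst) (measurableSet_singleton 0).compl).inter
      (measurable_residualMaker_mulVec (measurableSet_singleton 0))
  have hN0 : P.map (fun ω => ((fun (i : Fin n) (d : S) => X ω i d), fun i : Fin n => X ω i d)) N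
      = 0 := by
    have := Measure.isProbabilityMeasure_map (μ := P) hmS.aemeasurable
    rw [(indepFun_iff_map_prod_eq_prod_map_map hmS.aemeasurable hmd.aemeasurable).1 hpair,
      hlaw.map_eq, Measure.measure_prod_null hNm]
    refine ae_of_all _ fun A => ?_
    by_cases hA : ((Matrix.of A)ᵀ * Matrix.of A).det = 0
    · simp [hN, hA]
    · refine measure_mono_null (t := {x | residualMaker (Matrix.of A) *ᵥ x = 0})
        (fun x hx => hx.2) (measure_pi_gaussianReal_mulVec_eq_zero ?_ _ (by positivity))
      -- The projection has trace `n - |S| > 0`, so it cannot vanish.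
      intro h0
      have := trace_residualMaker (A := Matrix.of A) hA
      rw [h0, trace_zero, Fintype.card_coe] at this
      have : (S.card : ℝ) < n := by exact_mod_cast hS
      linarith
  rw [Measure.map_apply (hmS.prodMk hmd) hNm] at hN0
  filter_upwards [h, measure_eq_zero_iff_ae_notMem.1 hN0] with ω hω hωN
  rw [linearIndepOn_insert (by simpa using hd)]
  refine ⟨hω, fun hspan => hωN ?_⟩
  have hdet : ((cols (X ω) S)ᵀ * cols (X ω) S).det ≠ 0 := (det_gram_ne_zero_iff _).2 hω
  refine ⟨hdet, ?_⟩
  have key : ∀ x ∈ Submodule.span ℝ ((fun d i => X ω i d) '' (S : Set (Fin D))),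
      residualMaker (cols (X ω) S) *ᵥ x = 0 := by
    intro x hx
    induction hx using Submodule.span_induction with
    | mem x hx =>
      obtain ⟨e, he, rfl⟩ := hx
      ext i
      exact congrFun (congrFun (residualMaker_mul hdet) i) ⟨e, he⟩
    | zero => exact mulVec_zero _
    | add x y _ _ hx hy => rw [mulVec_add, hx, hy, add_zero]
    | smul a x _ hx => rw [mulVec_smul, hx, smul_zero]
  exact key _ hspan

/-- Gaussian columns, at most one of which is constant and equal to one, are almost surely linearly
independent. -/
theorem ae_linearIndepOn (hX : ∀ i d, Measurable fun ω => X ω i d)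
    (hXlaw : ∀ i d, HasLaw (fun ω => X ω i d) (gaussianReal (μ d) (σ d ^ 2)) P)
    (hind : iIndepFun (fun (p : Fin n × Fin D) ω => X ω p.1 p.2) P) {one : Option (Fin D)}
    (hone : ∀ d, one = some d → μ d = 1 ∧ σ d = 0) (hσ : ∀ d, one ≠ some d → 0 < σ d)
    (hS : S.card ≤ n) :
    ∀ᵐ ω ∂P, LinearIndepOn ℝ (fun d i => X ω i d) (S : Set (Fin D)) := by
  induction hk : S.card generalizing S with
  | zero =>
    rw [Finset.card_eq_zero] at hk
    subst hk
    simp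
  | succ k ih =>
    -- Nondegenerate columns are peeled off first, so a constant column is only met alone, where it
    -- suffices that the ones vector is nonzero (`n > 0`).
    by_cases h : ∃ d ∈ S, one ≠ some d
    · obtain ⟨d, hdS, hd⟩ := h
      have hcard : (S.erase d).card = k := by rw [Finset.card_erase_of_mem hdS, hk]; rfl
      have := ae_linearIndepOn_insert hX hXlaw hind (Finset.notMem_erase d S) (hσ d hd)
        (by omega) (ih (by omega) hcard)
      rwa [← Finset.coe_insert, Finset.insert_erase hdS] at this
    · push Not at h
      obtain ⟨d, hdS⟩ : S.Nonempty := Finset.card_pos.1 (by omega)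
      have hSd : S = {d} := by
        refine Finset.eq_singleton_iff_unique_mem.2 ⟨hdS, fun e he => ?_⟩
        exact Option.some.inj ((h e he).symm.trans (h d hdS))
      subst hSd
      have hlaw := hXlaw ⟨0, by simp at hS; omega⟩ d
      rw [(hone d (h d hdS)).1, (hone d (h d hdS)).2, zero_pow two_ne_zero,
        gaussianReal_zero_var] at hlaw
      filter_upwards [hlaw.ae_eq_of_dirac] with ω hω
      rw [Finset.coe_singleton, linearIndepOn_singleton_iff]
      intro h0
      have := congrFun h0 ⟨0, by simp at hS; omega⟩
      simp only [Pi.zero_apply] at this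
      rw [this] at hω
      exact zero_ne_one hω

end FullRank

/-! ### The law of the sum of squared residuals -/

theorem map_pi_gaussianReal_smul {ι : Type*} [Fintype ι] (r : ℝ≥0) :
    (Measure.pi fun _ : ι => gaussianReal 0 1).map (fun x i => √r * x i)
      = Measure.pi fun _ : ι => gaussianReal 0 r := by
  refine (measurePreserving_pi (fun _ : ι => gaussianReal 0 1) (fun _ : ι => gaussianReal 0 r)
    (f := fun _ y => √r * y) fun _ => ⟨by fun_prop, ?_⟩).map_eq
  rw [gaussianReal_map_const_mul, mul_zero]
  congr 1
  apply NNReal.eq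
  simp

/-- Probabilities for the squared length of the projection of a normal vector are bounded by those
for a chi-squared variable. -/
theorem measure_sum_sq_mulVec_mem_le {ι : Type*} [Fintype ι] {M : Matrix ι ι ℝ}
    (hM : M.IsHermitian) (hid : M * M = M) {k : ℕ} (hk : M.trace = k) {r : ℝ≥0} {C : Set ℝ}
    (hC : MeasurableSet C) {q : ℝ≥0∞}
    (h : ∀ s : Finset ι, s.card = k →
      (Measure.pi fun _ : ι => gaussianReal 0 1) {x | r * ∑ i ∈ s, x i ^ 2 ∈ C} ≤ q) :
    (Measure.pi fun _ : ι => gaussianReal 0 r) {x | ∑ i, (M *ᵥ x) i ^ 2 ∈ C} ≤ q := by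
  -- The set `s` comes from the spectrum of `M` and only its size is known, hence `h` for every set
  -- of size `k`.
  obtain ⟨s, hs, hmap⟩ := exists_map_sum_sq_mulVec_eq hM hid
  have hm : Measurable fun x : ι → ℝ => ∑ i, (M *ᵥ x) i ^ 2 := by
    simp only [mulVec, dotProduct]
    fun_prop
  have hC' : MeasurableSet ((fun y : ℝ => r * y) ⁻¹' C) := (by fun_prop : Measurable _) hC
  change (Measure.pi fun _ : ι => gaussianReal 0 r) ((fun x => ∑ i, (M *ᵥ x) i ^ 2) ⁻¹' C) ≤ q
  rw [← map_pi_gaussianReal_smul, Measure.map_apply (by fun_prop) (hm hC)]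
  have hset : (fun (x : ι → ℝ) i => √r * x i) ⁻¹' ((fun x => ∑ i, (M *ᵥ x) i ^ 2) ⁻¹' C)
      = (fun x : ι → ℝ => ∑ i, (M *ᵥ x) i ^ 2) ⁻¹' ((fun y : ℝ => r * y) ⁻¹' C) := by
    ext x
    have : (M *ᵥ fun i => √r * x i) = √r • (M *ᵥ x) := mulVec_smul M (√r) x
    simp [this, mul_pow, Finset.mul_sum]
  rw [hset, ← Measure.map_apply hm hC', hmap, Measure.map_apply (by fun_prop) hC']
  exact h s (by rw [hk] at hs; exact_mod_cast hs)

section Environment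

variable {Ω : Type*} [MeasurableSpace Ω] {P : Measure Ω} {n D : ℕ} {Sstar S : Finset (Fin D)}

/-- The response is a combination of columns in `S`, plus a constant vector, plus the omitted part.
The projection kills the first; the constant vector is a multiple of the intercept column or zero.
-/
theorem residualMaker_mulVec_response {x : Matrix (Fin n) (Fin D) ℝ} {ε : Fin n → ℝ}
    {b μ : Fin D → ℝ} (hdet : ((cols x S)ᵀ * cols x S).det ≠ 0) (hb : ∀ d ∉ Sstar, b d = 0)
    (hcentre : (∃ d ∈ S, ∀ i, x i d = 1) ∨ ∑ u ∈ Sstar \ S, b u * μ u = 0) :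
    residualMaker (cols x S) *ᵥ (x *ᵥ b + ε)
      = residualMaker (cols x S) *ᵥ omitted (Sstar \ S) b μ x ε := by
  have hcol : ∀ d ∈ S, residualMaker (cols x S) *ᵥ (fun i => x i d) = 0 := fun d hd => by
    ext i
    exact congrFun (congrFun (residualMaker_mul hdet) i) ⟨d, hd⟩
  have hconst : residualMaker (cols x S) *ᵥ (fun _ => ∑ u ∈ Sstar \ S, b u * μ u) = 0 := by
    rcases hcentre with ⟨d, hd, hone⟩ | h0
    · have : (fun _ : Fin n => ∑ u ∈ Sstar \ S, b u * μ u)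
          = (∑ u ∈ Sstar \ S, b u * μ u) • fun i => x i d := by
        ext i
        simp [hone]
      rw [this, mulVec_smul, hcol d hd, smul_zero]
    · rw [h0]
      exact mulVec_zero _
  have hsum : x *ᵥ b + ε = ∑ d ∈ S, b d • (fun i => x i d)
      + ((fun _ => ∑ u ∈ Sstar \ S, b u * μ u) + omitted (Sstar \ S) b μ x ε) := by
    ext i
    have hU : ∑ d, x i d * b d = ∑ d ∈ S, x i d * b d + ∑ d ∈ Sstar \ S, x i d * b d := by
      rw [← Finset.sum_union Finset.disjoint_sdiff, Finset.union_sdiff_self_eq_union]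
      refine (Finset.sum_subset (Finset.subset_univ _) fun d _ hd => ?_).symm
      rw [hb d fun h => hd (Finset.mem_union_right _ h), mul_zero]
    simp only [Pi.add_apply, mulVec, dotProduct, omitted, Finset.sum_apply, Pi.smul_apply,
      smul_eq_mul, hU, mul_sub, Finset.sum_sub_distrib]
    simp only [mul_comm (b _)]
    ring
  rw [hsum, mulVec_add, mulVec_add, hconst, zero_add, mulVec_sum, Finset.sum_eq_zero, zero_add]
  intro d hd
  rw [mulVec_smul, hcol d hd, smul_zero]

variable [IsProbabilityMeasure P] {X : Ω → Matrix (Fin n) (Fin D) ℝ} {Y ε : Ω → Fin n → ℝ}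
  {b μ : Fin D → ℝ} {σ : Fin D → ℝ≥0} {σY : ℝ≥0} {one : Option (Fin D)}

/-- Conditioning on `X_S` by Fubini: for each full-rank value the bound `q` holds, and it does not
depend on that value. A general `C` serves both tails. -/
theorem measure_ssr_mem_le (hX : ∀ i d, Measurable fun ω => X ω i d)
    (hε : ∀ i, Measurable fun ω => ε ω i)
    (hXlaw : ∀ i d, HasLaw (fun ω => X ω i d) (gaussianReal (μ d) (σ d ^ 2)) P)
    (hind : iIndepFun (fun (p : Fin n × Fin D) ω => X ω p.1 p.2) P)
    (hone : ∀ d, one = some d → μ d = 1 ∧ σ d = 0) (hσ : ∀ d, one ≠ some d → 0 < σ d)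
    (hεlaw : ∀ i, HasLaw (fun ω => ε ω i) (gaussianReal 0 (σY ^ 2)) P)
    (hεind : iIndepFun (fun i ω => ε ω i) P)
    (hnoise : IndepFun (fun ω => ε ω)
      (fun ω (i : Fin n) (d : ↥(S ∪ Sstar)) => X ω i d) P)
    (hY : ∀ᵐ ω ∂P, Y ω = X ω *ᵥ b + ε ω) (hb : ∀ d ∉ Sstar, b d = 0)
    (hcentre : (∃ d ∈ S, one = some d) ∨ ∑ u ∈ Sstar \ S, b u * μ u = 0)
    (hS : S.card ≤ n) {C : Set ℝ} (hC : MeasurableSet C) {q : ℝ≥0∞}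
    (h : ∀ s : Finset (Fin n), s.card = n - S.card →
      (Measure.pi fun _ : Fin n => gaussianReal 0 1)
        {x | resVar (Sstar \ S) b σ σY * ∑ i ∈ s, x i ^ 2 ∈ C} ≤ q) :
    P {ω | ssr S (X ω) (Y ω) ∈ C} ≤ q := by
  set r := (resVar (Sstar \ S) b σ σY).toNNReal with hr
  have hr' : (r : ℝ) = resVar (Sstar \ S) b σ σY := Real.coe_toNNReal _ (resVar_nonneg _ _ _ _)
  rw [← hr'] at h
  have hlaw := hasLaw_omitted (b := b) hX hε hXlaw hind hεlaw hεind hnoise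
  have hindep := indepFun_omitted (b := b) (μ := μ) hX hε hind hnoise
  have hmS : Measurable fun ω (i : Fin n) (d : S) => X ω i d := by fun_prop
  have hmW := measurable_omitted (b := b) (μ := μ) (Sstar \ S) hX hε
  -- The determinant condition empties the fibres over singular designs, so only genuine projections
  -- need a bound.
  set N : Set ((Fin n → S → ℝ) × (Fin n → ℝ)) :=
    {p | ((Matrix.of p.1)ᵀ * Matrix.of p.1).det ≠ 0 ∧
      ∑ i, (residualMaker (Matrix.of p.1) *ᵥ p.2) i ^ 2 ∈ C} with hN
  have hNm : MeasurableSet N := by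
    refine ((measurable_det_gram.comp measurable_fst) (measurableSet_singleton 0).compl).inter
      (s₂ := (fun p : (Fin n → S → ℝ) × (Fin n → ℝ) =>
        ∑ i, (residualMaker (Matrix.of p.1) *ᵥ p.2) i ^ 2) ⁻¹' C) (Measurable.comp
        (g := fun y : Fin n → ℝ => ∑ i, y i ^ 2) (by fun_prop) measurable_residualMaker_mulVec hC)
  have hNq : P.map (fun ω => ((fun (i : Fin n) (d : S) => X ω i d),
      omitted (Sstar \ S) b μ (X ω) (ε ω))) N ≤ q := by
    have := Measure.isProbabilityMeasure_map (μ := P) hmS.aemeasurable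
    rw [(indepFun_iff_map_prod_eq_prod_map_map hmS.aemeasurable hmW.aemeasurable).1 hindep,
      hlaw.map_eq, Measure.prod_apply hNm]
    refine (lintegral_mono (g := fun _ => q) fun A => ?_).trans (by simp)
    by_cases hA : ((Matrix.of A)ᵀ * Matrix.of A).det = 0
    · simp [hN, hA]
    · refine (measure_mono (t := {w | ∑ i, (residualMaker (Matrix.of A) *ᵥ w) i ^ 2 ∈ C})
        fun w hw => hw.2).trans ?_
      refine measure_sum_sq_mulVec_mem_le (residualMaker_isHermitian _) (residualMaker_mul_self hA)
        ?_ hC h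
      rw [trace_residualMaker hA, Fintype.card_coe, Nat.cast_sub hS]
  rw [Measure.map_apply (hmS.prodMk hmW) hNm] at hNq
  refine (measure_mono_ae ?_).trans hNq
  have hcol : ∀ᵐ ω ∂P, (∃ d ∈ S, ∀ i, X ω i d = 1) ∨ ∑ u ∈ Sstar \ S, b u * μ u = 0 := by
    rcases hcentre with ⟨d, hd, hdone⟩ | h0
    · have : ∀ᵐ ω ∂P, ∀ i, X ω i d = 1 := by
        rw [ae_all_iff]
        intro i
        have hl := hXlaw i d
        rw [(hone d hdone).1, (hone d hdone).2, zero_pow two_ne_zero, gaussianReal_zero_var] at hl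
        exact hl.ae_eq_of_dirac
      filter_upwards [this] with ω hω using Or.inl ⟨d, hd, hω⟩
    · exact ae_of_all _ fun _ => Or.inr h0
  filter_upwards [hY, hcol, ae_linearIndepOn hX hXlaw hind hone hσ hS] with ω hω hc hli hmem
  have hdet : ((cols (X ω) S)ᵀ * cols (X ω) S).det ≠ 0 := (det_gram_ne_zero_iff _).2 hli
  refine ⟨hdet, ?_⟩
  change ∑ i, (residualMaker (cols (X ω) S) *ᵥ omitted (Sstar \ S) b μ (X ω) (ε ω)) i ^ 2 ∈ C
  rw [← residualMaker_mulVec_response hdet hb hc, ← hω, ← residual_eq_residualMaker_mulVec hdet]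
  exact hmem

end Environment

/-! ### The p-value and the acceptance probability -/

theorem refLaw_eq {E n D : ℕ} {S : Finset (Fin D)} {X : Fin E → Matrix (Fin n) (Fin D) ℝ}
    (hdet : ∀ e, ((cols (X e) S)ᵀ * cols (X e) S).det ≠ 0) :
    refLaw S X = Measure.pi fun _ => chiSq (n - S.card) := by
  rw [refLaw]
  congr 1
  ext1 e
  rw [rank_of_isUnit _ ((isUnit_iff_isUnit_det _).2 (hdet e).isUnit), Fintype.card_coe]

instance {E n D : ℕ} (S : Finset (Fin D)) (X : Fin E → Matrix (Fin n) (Fin D) ℝ) :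
    IsProbabilityMeasure (refLaw S X) := by
  rw [refLaw]; infer_instance

theorem measureReal_pi_chiSq_bad_le (E k : ℕ) {q : ℝ} (hq0 : 0 < q) (hq1 : q < 1) :
    (Measure.pi fun _ : Fin E => chiSq k).real {z | ∃ e, z e ≤ q * k ∨ 1 / q * k ≤ z e}
      ≤ E * (bump (1 / q) ^ ((k : ℝ) / 2) + bump q ^ ((k : ℝ) / 2)) := by
  have hq : 1 < 1 / q := by rwa [lt_div_iff₀ hq0, one_mul]
  have hset : {z : Fin E → ℝ | ∃ e, z e ≤ q * k ∨ 1 / q * k ≤ z e}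
      = ⋃ e, Function.eval e ⁻¹' ({y | 1 / q * k ≤ y} ∪ {y | y ≤ q * k}) := by
    ext z
    simp [or_comm]
  have hm : MeasurableSet ({y : ℝ | 1 / q * k ≤ y} ∪ {y | y ≤ q * k}) :=
    measurableSet_Ici.union measurableSet_Iic
  rw [hset]
  refine (measureReal_iUnion_fintype_le _).trans ?_
  refine (Finset.sum_le_card_nsmul _ _ (bump (1 / q) ^ ((k : ℝ) / 2) + bump q ^ ((k : ℝ) / 2))
    fun e _ => ?_).trans
    (by rw [Finset.card_univ, Fintype.card_fin, nsmul_eq_mul])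
  rw [(measurePreserving_eval (fun _ : Fin E => chiSq k) e).measureReal_preimage
    hm.nullMeasurableSet]
  exact (measureReal_union_le _ _).trans
    (add_le_add (chiSq_real_ge_le k hq) (chiSq_real_le_le k hq0 hq1))

theorem statT_le {E n D : ℕ} {S : Finset (Fin D)} {X : Fin E → Matrix (Fin n) (Fin D) ℝ}
    {Y : Fin E → Fin n → ℝ} {a c : Fin E} {A C : ℝ} (hC : 0 < C) (ha : ssr S (X a) (Y a) ≤ A)
    (hc : C ≤ ssr S (X c) (Y c)) : statT S X Y ≤ ENNReal.ofReal (A / C) := by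
  have h0 : ∀ e, 0 ≤ ssr S (X e) (Y e) := fun e => Finset.sum_nonneg fun _ _ => sq_nonneg _
  rw [statT, if_pos ⟨c, hC.trans_le hc⟩]
  refine ENNReal.ofReal_le_ofReal (div_le_div₀ ((h0 a).trans ha) ?_ hC ?_)
  · exact (ciInf_le (Set.finite_range _).bddBelow a).trans ha
  · exact hc.trans (le_ciSup (f := fun e => ssr S (X e) (Y e)) (Set.finite_range _).bddAbove c)

theorem le_iInf_div_iSup {E : ℕ} [Nonempty (Fin E)] {z : Fin E → ℝ} {A C : ℝ} (hA : 0 < A)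
    (h1 : ∀ e, A ≤ z e) (h2 : ∀ e, z e ≤ C) : A / C ≤ (⨅ e, z e) / (⨆ e, z e) := by
  obtain ⟨a⟩ := ‹Nonempty (Fin E)›
  have : Nonempty (Fin E) := ⟨a⟩
  have hinf : A ≤ ⨅ e, z e := le_ciInf h1
  have hsup : ⨆ e, z e ≤ C := ciSup_le h2
  exact div_le_div₀ (hA.le.trans hinf) hinf
    ((hA.trans_le (h1 a)).trans_le (le_ciSup (Set.finite_range z).bddAbove a)) hsup

theorem pValue_le {E n D : ℕ} {S : Finset (Fin D)} {X : Fin E → Matrix (Fin n) (Fin D) ℝ}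
    {Y : Fin E → Fin n → ℝ} (hdet : ∀ e, ((cols (X e) S)ᵀ * cols (X e) S).det ≠ 0)
    (hS : S.card < n) {a c : Fin E} {ra rc q : ℝ} (hrc : 0 < rc) (hq0 : 0 < q)
    (hq1 : q < 1) (hr : ra = q ^ 4 * rc)
    (ha : ssr S (X a) (Y a) ≤ ra * (1 / q * (n - S.card : ℕ)))
    (hc : rc * (q * (n - S.card : ℕ)) ≤ ssr S (X c) (Y c)) :
    pValue S X Y ≤ ENNReal.ofReal (E * (bump (1 / q) ^ (((n - S.card : ℕ) : ℝ) / 2)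
      + bump q ^ (((n - S.card : ℕ) : ℝ) / 2))) := by
  have hk : (0 : ℝ) < (n - S.card : ℕ) := by exact_mod_cast Nat.sub_pos_of_lt hS
  set k := n - S.card
  have : Nonempty (Fin E) := ⟨a⟩
  refine le_trans ?_ (ENNReal.ofReal_le_ofReal (measureReal_pi_chiSq_bad_le E k hq0 hq1))
  rw [ofReal_measureReal, pValue, refLaw_eq hdet]
  refine measure_mono fun z hz => ?_
  by_contra hgood
  simp only [Set.mem_ofPred_eq, not_exists, not_or, not_le] at hgood hz
  have h1 := le_iInf_div_iSup (mul_pos hq0 hk) (fun e => (hgood e).1.le) fun e => (hgood e).2.le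
  have h2 := statT_le (X := X) (by positivity) ha hc
  -- Both sides equal `q²`: the factor `q⁴` in `ra` loses `q²` to the two data deviations.
  have h3 : ra * (1 / q * k) / (rc * (q * k)) = q * k / (1 / q * k) := by
    rw [hr]
    field_simp
  rw [h3] at h2
  exact absurd (hz.trans_le (h2.trans (ENNReal.ofReal_le_ofReal h1))) (lt_irrefl _)

theorem lt_pValue_of_phi_eq_zero {E n D : ℕ} {S : Finset (Fin D)}
    {X : Fin E → Matrix (Fin n) (Fin D) ℝ} {Y : Fin E → Fin n → ℝ} {α : ℝ}
    (h : phi S X Y α = 0) : ENNReal.ofReal α < pValue S X Y := by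
  by_contra! hle
  simp [phi, hle] at h

/-- The probability of accepting a set is small if the residuals of one environment are likely to
be much smaller than those of another one. -/
theorem measureReal_phi_eq_zero_le {Ω : Type*} [MeasurableSpace Ω] {P : Measure Ω}
    [IsProbabilityMeasure P] {E n D : ℕ} {S : Finset (Fin D)}
    {X : Fin E → Ω → Matrix (Fin n) (Fin D) ℝ} {Y : Fin E → Ω → Fin n → ℝ}
    (hdet : ∀ᵐ ω ∂P, ∀ e, ((cols (X e ω) S)ᵀ * cols (X e ω) S).det ≠ 0) (hS : S.card < n)
    {a c : Fin E} {ra rc q : ℝ} (hrc : 0 < rc) (hq0 : 0 < q) (hq1 : q < 1) (hr : ra = q ^ 4 * rc)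
    (ha : P {ω | ssr S (X a ω) (Y a ω) ∈ Set.Ici (ra * (1 / q * (n - S.card : ℕ)))}
      ≤ ENNReal.ofReal (bump (1 / q) ^ (((n - S.card : ℕ) : ℝ) / 2)))
    (hc : P {ω | ssr S (X c ω) (Y c ω) ∈ Set.Iic (rc * (q * (n - S.card : ℕ)))}
      ≤ ENNReal.ofReal (bump q ^ (((n - S.card : ℕ) : ℝ) / 2)))
    {α : ℝ} (hα : 0 < α) :
    P.real {ω | phi S (fun e => X e ω) (fun e => Y e ω) α = 0}
      ≤ 4 * E / α * (bump (1 / q) ^ (((n - S.card : ℕ) : ℝ) / 2)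
        + bump q ^ (((n - S.card : ℕ) : ℝ) / 2)) := by
  set k := n - S.card
  set b1 := bump (1 / q) ^ ((k : ℝ) / 2) with hb1
  set b2 := bump q ^ ((k : ℝ) / 2) with hb2
  have h1 : 0 ≤ b1 := (Real.rpow_pos_of_pos (bump_pos (by positivity)) _).le
  have h2 : 0 ≤ b2 := (Real.rpow_pos_of_pos (bump_pos hq0) _).le
  have hE : (1 : ℝ) ≤ E := by exact_mod_cast (Fin.pos a)
  -- For `α ≥ 1` the test always rejects, as p-values are at most 1. For `α < 1` the prefactor `4 *
  -- E / α` exceeds 1; the 4 is slack.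
  rcases le_or_gt 1 α with hα1 | hα1
  · have : {ω | phi S (fun e => X e ω) (fun e => Y e ω) α = 0} = ∅ := by
      refine Set.eq_empty_of_forall_notMem fun ω hω => ?_
      have h := lt_pValue_of_phi_eq_zero hω
      have hle : (1 : ℝ≥0∞) ≤ ENNReal.ofReal α := by simpa using hα1
      exact absurd (hle.trans_lt h) (not_lt.2 prob_le_one)
    rw [this, measureReal_empty]
    positivity
  rcases le_or_gt (E * (b1 + b2)) α with hle | hgt
  · have hsub : P {ω | phi S (fun e => X e ω) (fun e => Y e ω) α = 0}
        ≤ P ({ω | ssr S (X a ω) (Y a ω) ∈ Set.Ici (ra * (1 / q * k))}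
          ∪ {ω | ssr S (X c ω) (Y c ω) ∈ Set.Iic (rc * (q * k))}) := by
      refine measure_mono_ae ?_
      filter_upwards [hdet] with ω hω hphi
      by_contra hgood
      have hgood' : ¬ (ssr S (X a ω) (Y a ω) ∈ Set.Ici (ra * (1 / q * k))
        ∨ ssr S (X c ω) (Y c ω) ∈ Set.Iic (rc * (q * k))) := hgood
      simp only [Set.mem_Ici, Set.mem_Iic, not_or, not_le] at hgood'
      have hp := pValue_le (X := fun e => X e ω) (Y := fun e => Y e ω) hω hS hrc hq0 hq1 hr
        hgood'.1.le hgood'.2.le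
      exact absurd (lt_pValue_of_phi_eq_zero hphi)
        (not_lt.2 (hp.trans (ENNReal.ofReal_le_ofReal hle)))
    have hb : P.real {ω | phi S (fun e => X e ω) (fun e => Y e ω) α = 0} ≤ b1 + b2 := by
      refine ENNReal.toReal_le_of_le_ofReal (by positivity) ?_
      rw [ENNReal.ofReal_add h1 h2]
      exact hsub.trans ((measure_union_le _ _).trans (add_le_add ha hc))
    refine hb.trans (le_mul_of_one_le_left (by positivity) ?_)
    rw [le_div_iff₀ hα]
    linarith
  -- Here `α < E (b1 + b2)`, so the right-hand side is above 1.
  · refine measureReal_le_one.trans ?_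
    rw [div_mul_eq_mul_div, le_div_iff₀ hα]
    nlinarith

/-! ### The exponential rate and the theorem -/

/-- `exp (-(decayRate I * k))` is the larger base to the power `k/2`, and both bases are below 1
since `I ^ (1/4) ≠ 1`. -/
theorem decayRate_pos_and_le {I : ℝ} (h0 : 0 < I) (h1 : I < 1) :
    0 < decayRate I ∧ ∀ k : ℕ,
      bump (1 / I ^ (1 / 4 : ℝ)) ^ ((k : ℝ) / 2) + bump (I ^ (1 / 4 : ℝ)) ^ ((k : ℝ) / 2)
        ≤ 2 * Real.exp (-(decayRate I * k)) := by
  have hq0 : 0 < I ^ (1 / 4 : ℝ) := Real.rpow_pos_of_pos h0 _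
  have hq1 : I ^ (1 / 4 : ℝ) < 1 := Real.rpow_lt_one h0.le h1 (by norm_num)
  set q := I ^ (1 / 4 : ℝ)
  have hq2 : 1 < 1 / q := by rwa [lt_div_iff₀ hq0, one_mul]
  have hp1 : 0 < bump (1 / q) := bump_pos (by positivity)
  have hp2 : 0 < bump q := bump_pos hq0
  have hmax : 0 < max (bump (1 / q)) (bump q) := lt_max_of_lt_left hp1
  have hmax1 : max (bump (1 / q)) (bump q) < 1 := max_lt (bump_lt_one hq2.ne') (bump_lt_one hq1.ne)
  have hd : decayRate I = -(Real.log (max (bump (1 / q)) (bump q))) / 2 := rfl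
  refine ⟨by rw [hd]; linarith [Real.log_neg hmax hmax1], fun k => ?_⟩
  have he : Real.exp (-(decayRate I * k)) = max (bump (1 / q)) (bump q) ^ ((k : ℝ) / 2) := by
    rw [hd, Real.rpow_def_of_pos hmax]
    congr 1
    ring
  rw [he, two_mul]
  exact add_le_add (Real.rpow_le_rpow hp1.le (le_max_left _ _) (by positivity))
    (Real.rpow_le_rpow hp2.le (le_max_right _ _) (by positivity))

theorem resVar_pos {D : ℕ} (U : Finset (Fin D)) (b : Fin D → ℝ) (s : Fin D → ℝ≥0) {σY : ℝ≥0}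
    (h : 0 < σY) : 0 < resVar U b s σY := by
  have : (0 : ℝ) < σY := h
  rw [resVar]
  positivity

theorem measureReal_phi_eq_zero_le_heteroRatio {Ω : Type*} [MeasurableSpace Ω] (P : Measure Ω)
    [IsProbabilityMeasure P] {E n D : ℕ}
    {X : Fin E → Ω → Matrix (Fin n) (Fin D) ℝ} {Y ε : Fin E → Ω → Fin n → ℝ}
    {β : Fin E → Fin D → ℝ} {Sstar : Finset (Fin D)} {F : Measure ℝ} {σY : ℝ≥0}
    {E1 E2 : Finset (Fin E)} {β1 β2 : Fin D → ℝ} {μ : Fin E → Fin D → ℝ}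
    {σ : Fin E → Fin D → ℝ≥0} {one : Option (Fin D)}
    (hpop : PopulationModel P X Y ε β Sstar F)
    (hgauss : GaussianNoise P ε F σY)
    (htwo : TwoTypeEnvironments P X β E1 E2 β1 β2 μ σ one)
    {S : Finset (Fin D)} (hn : S.card < n)
    (hnoise : ∀ e, IndepFun (fun ω => ε e ω)
      (fun ω (i : Fin n) (d : ↥(S ∪ Sstar)) => X e ω i d) P)
    (hcentre : (∃ d ∈ S, one = some d) ∨ ∀ e, ∑ u ∈ Sstar \ S, β e u * μ e u = 0)
    {a c : Fin E} {q : ℝ} (hq0 : 0 < q) (hq1 : q < 1)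
    (hq : resVar (Sstar \ S) (β a) (σ a) σY / resVar (Sstar \ S) (β c) (σ c) σY = q ^ 4)
    {α : ℝ} (hα : 0 < α) :
    P.real {ω | phi S (fun e => X e ω) (fun e => Y e ω) α = 0}
      ≤ 4 * E / α * (bump (1 / q) ^ (((n - S.card : ℕ) : ℝ) / 2)
        + bump q ^ (((n - S.card : ℕ) : ℝ) / 2)) := by
  have hlaw : ∀ e i, HasLaw (fun ω => ε e ω i) (gaussianReal 0 (σY ^ 2)) P := fun e i =>
    hgauss.law_eq ▸ hpop.noise_law e i
  have hra := resVar_pos (Sstar \ S) (β a) (σ a) hgauss.sd_pos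
  have hrc := resVar_pos (Sstar \ S) (β c) (σ c) hgauss.sd_pos
  have htail := fun (e : Fin E) {C : Set ℝ} (hC : MeasurableSet C) (q : ℝ≥0∞) =>
    measure_ssr_mem_le (Y := Y e) (b := β e) (C := C) (q := q) (hpop.measurable_X e)
    (hpop.measurable_noise e) (htwo.covariate_law e) (htwo.covariate_indep e)
    (fun d hd => htwo.column_one d hd e) (fun d hd => htwo.sd_pos d hd e) (hlaw e)
    (hpop.noise_indep e) (hnoise e) (hpop.model e) (hpop.coeff_eq_zero e)
    (hcentre.imp_right fun h => h e) hn.le hC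
  have hq2 : 1 < 1 / q := by rwa [lt_div_iff₀ hq0, one_mul]
  refine measureReal_phi_eq_zero_le (a := a) (c := c) ?_ hn hrc hq0 hq1
    ((div_eq_iff hrc.ne').1 hq) ?_ ?_ hα
  · rw [ae_all_iff]
    intro e
    filter_upwards [ae_linearIndepOn (hpop.measurable_X e) (htwo.covariate_law e)
      (htwo.covariate_indep e) (fun d hd => htwo.column_one d hd e)
      (fun d hd => htwo.sd_pos d hd e) hn.le] with ω hω
    exact (det_gram_ne_zero_iff _).2 hω
  · refine htail a measurableSet_Ici _ fun s hs => ?_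
    simp only [Set.mem_Ici, mul_le_mul_iff_right₀ hra]
    rw [← hs, ← ofReal_measureReal]
    exact ENNReal.ofReal_le_ofReal (measureReal_sum_sq_ge_le s hq2)
  · refine htail c measurableSet_Iic _ fun s hs => ?_
    simp only [Set.mem_Iic, mul_le_mul_iff_right₀ hrc]
    rw [← hs, ← ofReal_measureReal]
    exact ENNReal.ofReal_le_ofReal (measureReal_sum_sq_le_le s hq0 hq1)

end LoLICaP

theorem theorem2 {Ω : Type*} [MeasurableSpace Ω] (P : Measure Ω) [IsProbabilityMeasure P]
    {E n D : ℕ}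
    (X : Fin E → Ω → Matrix (Fin n) (Fin D) ℝ) (Y ε : Fin E → Ω → Fin n → ℝ)
    (β : Fin E → Fin D → ℝ) (Sstar : Finset (Fin D)) (F : Measure ℝ) (σY : ℝ≥0)
    (E1 E2 : Finset (Fin E)) (β1 β2 : Fin D → ℝ) (μ : Fin E → Fin D → ℝ)
    (σ : Fin E → Fin D → ℝ≥0) (one : Option (Fin D))
    (hpop : LoLICaP.PopulationModel P X Y ε β Sstar F)
    (hgauss : LoLICaP.GaussianNoise P ε F σY)
    (htwo : LoLICaP.TwoTypeEnvironments P X β E1 E2 β1 β2 μ σ one)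
    (S : Finset (Fin D)) (hS : ¬ Sstar ⊆ S) (hn : S.card < n)
    -- the noise of an environment is independent of the covariates in `S ∪ S*`
    (hnoise : ∀ e, IndepFun (fun ω => ε e ω)
      (fun ω (i : Fin n) (d : ↥(S ∪ Sstar)) => X e ω i d) P)
    -- the regression on `X_S` includes the constant column, or the omitted part is centred
    (hcentre : (∃ d ∈ S, one = some d) ∨ ∀ e, ∑ u ∈ Sstar \ S, β e u * μ e u = 0)
    (v w : Fin E) (hv : v ∈ E1) (hw : w ∈ E2)
    (I : ℝ) (hI : I = LoLICaP.heteroRatio Sstar S β1 β2 (σ v) (σ w) σY) (hI1 : I < 1)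
    (α : ℝ) (hα : 0 < α) (k : ℕ) (hk : k = n - S.card) :
    P.real {ω | LoLICaP.phi S (fun e => X e ω) (fun e => Y e ω) α = 0} ≤
        4 * E / α *
          ((1 / I ^ (1 / 4 : ℝ) * Real.exp (1 - 1 / I ^ (1 / 4 : ℝ))) ^ ((k : ℝ) / 2) +
            (I ^ (1 / 4 : ℝ) * Real.exp (1 - I ^ (1 / 4 : ℝ))) ^ ((k : ℝ) / 2)) ∧
      (∀ c : ℝ, c ≠ 1 → c * Real.exp (1 - c) < 1) ∧
      0 < LoLICaP.decayRate I ∧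
      P.real {ω | LoLICaP.phi S (fun e => X e ω) (fun e => Y e ω) α = 0} ≤
        8 * E / α * Real.exp (-(LoLICaP.decayRate I * k)) := by
  have hρ1 := LoLICaP.resVar_pos (Sstar \ S) β1 (σ v) hgauss.sd_pos
  have hρ2 := LoLICaP.resVar_pos (Sstar \ S) β2 (σ w) hgauss.sd_pos
  have hI0 : 0 < I := hI ▸ lt_min (div_pos hρ1 hρ2) (div_pos hρ2 hρ1)
  have hq0 : 0 < I ^ (1 / 4 : ℝ) := Real.rpow_pos_of_pos hI0 _
  have hq1 : I ^ (1 / 4 : ℝ) < 1 := Real.rpow_lt_one hI0.le hI1 (by norm_num)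
  have hq4 : (I ^ (1 / 4 : ℝ)) ^ 4 = I := by
    rw [← Real.rpow_natCast, ← Real.rpow_mul hI0.le]
    norm_num
  have hmain : P.real {ω | LoLICaP.phi S (fun e => X e ω) (fun e => Y e ω) α = 0} ≤
      4 * E / α * (LoLICaP.bump (1 / I ^ (1 / 4 : ℝ)) ^ ((k : ℝ) / 2)
        + LoLICaP.bump (I ^ (1 / 4 : ℝ)) ^ ((k : ℝ) / 2)) := by
    rw [hk]
    -- The ratio attaining the minimum decides which of `v`, `w` is the environment `a` of smaller
    -- residual variance.
    rcases min_choice (LoLICaP.resVar (Sstar \ S) β1 (σ v) σY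
      / LoLICaP.resVar (Sstar \ S) β2 (σ w) σY) (LoLICaP.resVar (Sstar \ S) β2 (σ w) σY
      / LoLICaP.resVar (Sstar \ S) β1 (σ v) σY) with h | h
    · refine LoLICaP.measureReal_phi_eq_zero_le_heteroRatio P hpop hgauss htwo hn hnoise hcentre
        (a := v) (c := w) hq0 hq1 ?_ hα
      rw [htwo.coeff_left v hv, htwo.coeff_right w hw, hq4, hI, LoLICaP.heteroRatio, h]
    · refine LoLICaP.measureReal_phi_eq_zero_le_heteroRatio P hpop hgauss htwo hn hnoise hcentre
        (a := w) (c := v) hq0 hq1 ?_ hα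
      rw [htwo.coeff_left v hv, htwo.coeff_right w hw, hq4, hI, LoLICaP.heteroRatio, h]
  obtain ⟨hrate, hle⟩ := LoLICaP.decayRate_pos_and_le hI0 hI1
  refine ⟨hmain, fun c hc => LoLICaP.bump_lt_one hc, hrate, hmain.trans ?_⟩
  calc _ ≤ 4 * E / α * (2 * Real.exp (-(LoLICaP.decayRate I * k))) :=
        mul_le_mul_of_nonneg_left (hle k) (by positivity)
    _ = 8 * E / α * Real.exp (-(LoLICaP.decayRate I * k)) := by ring
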